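/- Fix an integer $k\ge 1$ and real numbers $a\neq 0$, $w$, $\sigma_0\ge 0$, $\sigma_v>0$, $\sigma_v'>0$, $P\ge 0$ with $0<w<1$ and $\left|\frac{1}{a^2w}\right|<1$. All logarithms are to base $2$. ($k$-step MIMO state amplification with feedback.) Let $x[0]\sim\mathcal N(0,\sigma_0^2)$ and let $v_2[0],\dots,v_2[k-1]$ be real random variables such that $x[0],v_2[0],\dots,v_2[k-1]$ are independent. The transmitter's inputs are $$u_1[n]=f_n(x[0],v_2[0],\dots,v_2[n-1]),\qquad 0\le n\le k-2,$$ with measurable functions $f_n$ (so $u_1[0]=f_0(x[0])$), the receiver's observations are $$y_2[n]=a^n x[0]+\sum_{i=0}^{n-1}a^{n-1-i}u_1[i]+v_2[n],\qquad 0\le n\le k-1,$$ and the receiver's estimate is $\widehat{x[0]}=g(y_2[0],\dots,y_2[k-1])$ with a measurable function $g$. Suppose that the discounted power constraint $$\sum_{n=0}^{k-2}(1-w)\,w^n\,\mathbb E\big[u_1^2[n]\big]\le P$$ holds. Then, for all such $f_n$ and $g$: (i) If $v_2[n]\sim\mathcal N(0,\sigma_v^2)$ for all $0\le n\le k-1$,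 then $$\mathbb E\big[(x[0]-\widehat{x[0]})^2\big]\ge\frac{\sigma_0^2}{2^{2I_k}},\qquad I_k=\frac k2\log\left(1+\frac1{k\sigma_v^2}\left(\frac{2a^{2(k-1)}\sigma_0^2}{1-a^{-2}}+\frac{2a^{2(k-2)}}{1-a^{-2}}\,\frac{P}{\left(1-\frac1{a^2w}\right)(1-w)}\right)\right).$$ (ii) If $v_2[n]\sim\mathcal N(0,\sigma_v^2)$ for $0\le n\le k-2$ and $v_2[k-1]\sim\mathcal N(0,\sigma_v'^2)$, then $$\mathbb E\big[(x[0]-\widehat{x[0]})^2\big]\ge\frac{\sigma_0^2}{2^{2I_k'}},\qquad I_k'=I_{k-1}+\frac12\log\left(1+\frac1{\sigma_v'^2}\left(2a^{2(k-1)}\sigma_0^2+2\,\frac{a^{2(k-2)}}{1-\frac1{a^2w}}\,\frac{P}{1-w}\right)\right),$$ where $I_{k-1}$ is the expression of (i) with $k-1$ in place of $k$, and $I_0=0$. (iii) If $v_2[n]\sim\mathcal N(0,\sigma_v^2)$ for $0\le n\le k-2$ and $v_2[k-1]$ is uniform on $[-\sigma_v',\sigma_v']$, then $$\mathbb E\big[(x[0]-\widehat{x[0]})^2\big]\ge\frac{\sigma_0^2}{2^{2I_k''}},\qquad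 I_k''=I_k'+\frac12\log\left(\frac{\pi e}{2}\right).$$ -/

import Mathlib

open MeasureTheory ProbabilityTheory

noncomputable section

namespace StateAmplification

/-- The law of the noise that is uniform on the interval `[-s, s]`. -/
def uniformNoise (s : ℝ) : Measure ℝ :=
  ProbabilityTheory.cond volume (Set.Icc (-s) s)

/-- The underlying random variables of the problem over the times `0, …, k - 1`:
the source `x₀` is `𝓝(0, σ₀²)`, the observation noise `v n` has the law `ν n`, and
`x₀, v 0, …, v (k - 1)` are jointly independent. -/
structure SourceAndNoise {Ω : Type*} [MeasurableSpace Ω] (μ : Measure Ω) (k : ℕ) (σ₀ : ℝ)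
    (ν : ℕ → Measure ℝ) (x₀ : Ω → ℝ) (v : ℕ → Ω → ℝ) : Prop where
  source_law : HasLaw x₀ (gaussianReal 0 (σ₀ ^ 2).toNNReal) μ
  noise_law : ∀ n < k, HasLaw (v n) (ν n) μ
  indep : iIndepFun (fun i : Option (Fin k) => i.elim x₀ (fun n : Fin k => v n)) μ

/-- The transmitter's input at time `n`: a function of the source and, by causal feedback, of the
noises `v 0, …, v (n - 1)`. -/
def input (f : (n : ℕ) → ℝ → (Fin n → ℝ) → ℝ) (x : ℝ) (v : ℕ → ℝ) (n : ℕ) : ℝ :=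
  f n x (fun j : Fin n => v j)

/-- The receiver's observation `y[n] = aⁿ x₀ + ∑_{i < n} a^{n-1-i} u[i] + v[n]`. -/
def observation (a : ℝ) (f : (n : ℕ) → ℝ → (Fin n → ℝ) → ℝ) (x : ℝ) (v : ℕ → ℝ) (n : ℕ) : ℝ :=
  a ^ n * x + ∑ i ∈ Finset.range n, a ^ (n - 1 - i) * input f x v i + v n

/-- The second moment `𝔼[X²]`, with the value `∞` when `X` is not square integrable. -/
def secondMoment {Ω : Type*} [MeasurableSpace Ω] (μ : Measure Ω) (X : Ω → ℝ) : ENNReal :=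
  ∫⁻ ω, ENNReal.ofReal (X ω ^ 2) ∂μ

/-- The receiver's mean square error `𝔼[(x₀ - g(y[0], …, y[k-1]))²]`. -/
def meanSquareError {Ω : Type*} [MeasurableSpace Ω] (μ : Measure Ω) (k : ℕ) (a : ℝ)
    (f : (n : ℕ) → ℝ → (Fin n → ℝ) → ℝ) (g : (Fin k → ℝ) → ℝ)
    (x₀ : Ω → ℝ) (v : ℕ → Ω → ℝ) : ENNReal :=
  secondMoment μ fun ω =>
    x₀ ω - g (fun n : Fin k => observation a f (x₀ ω) (fun j => v j ω) n)

/-- The discounted input power `∑_{n = 0}^{k-2} (1 - w) wⁿ 𝔼[u[n]²]`. -/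
def discountedPower {Ω : Type*} [MeasurableSpace Ω] (μ : Measure Ω) (k : ℕ) (w : ℝ)
    (f : (n : ℕ) → ℝ → (Fin n → ℝ) → ℝ) (x₀ : Ω → ℝ) (v : ℕ → Ω → ℝ) : ENNReal :=
  ∑ n ∈ Finset.range (k - 1), ENNReal.ofReal ((1 - w) * w ^ n) *
    secondMoment μ fun ω => input f (x₀ ω) (fun j => v j ω) n

/-- The information bound `I_k`, in bits (`I_0 = 0`). -/
def infoBound (a w σ₀ σv P : ℝ) (k : ℕ) : ℝ :=
  (k : ℝ) / 2 * Real.logb 2 (1 + 1 / ((k : ℝ) * σv ^ 2) *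
    (2 * a ^ (2 * ((k : ℤ) - 1)) * σ₀ ^ 2 / (1 - a ^ (-2 : ℤ)) +
      2 * a ^ (2 * ((k : ℤ) - 2)) / (1 - a ^ (-2 : ℤ)) *
        (P / ((1 - 1 / (a ^ 2 * w)) * (1 - w)))))

/-- The information bound `I_k'`, in bits, with the parameter `σv'` of the last noise. -/
def infoBound' (a w σ₀ σv σv' P : ℝ) (k : ℕ) : ℝ :=
  infoBound a w σ₀ σv P (k - 1) + 1 / 2 * Real.logb 2 (1 + 1 / σv' ^ 2 *
    (2 * a ^ (2 * ((k : ℤ) - 1)) * σ₀ ^ 2 +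
      2 * (a ^ (2 * ((k : ℤ) - 2)) / (1 - 1 / (a ^ 2 * w))) * (P / (1 - w))))

/-- The information bound `I_k''`, in bits. -/
def infoBound'' (a w σ₀ σv σv' P : ℝ) (k : ℕ) : ℝ :=
  infoBound' a w σ₀ σv σv' P k + 1 / 2 * Real.logb 2 (Real.pi * Real.exp 1 / 2)

end StateAmplification

end

/-!
The proof bounds the information about the source by one application of Gibbs' inequality
`E[log q] ≤ E[log p]` (`integral_log_le_of_lintegral_exp_le_one`), instead of a chain of
inequalities between conditional differential entropies.

Here `p` is the joint density of the source and the noises, and `q` compares the true outputs with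
an idealised model: the outputs `y[n]` are independent centred Gaussians with variances `τ n` and,
given the outputs, the estimation error `x₀ - g(y)` is a centred Gaussian with variance `D`. Because
of the causal feedback, for a fixed source the map from the noises to the outputs adds to each
coordinate a function of the earlier ones, so it preserves Lebesgue measure
(`measurePreserving_causalShift`); hence `q` is a probability density also in the coordinates source
and noises (`lintegral_comparison_eq_one`). Both logarithms are, up to the density of a uniform
noise, quadratic, and if the mean square error is at most `D`, their expectations give
`log σ₀² - log D ≤ ∑ₙ (log (2π τ n) + E[y[n]²] / τ n - 2 h n)`, with `h n` the entropy of the noise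
`v n` (`log_div_le_sum`).

Since `v n` is independent of the state `s n = y[n] - v n`, the output power `E[y[n]²]` is
`E[s n²] + E[v n²]`, and the Cauchy–Schwarz inequality with the discount weights `wⁱ` gives
`E[s n²] ≤ a²ⁿ B` for a constant `B` (`integral_state_sq_le`). Taking the same `τ` for all noises of
variance `σv²`, namely `σv²` plus a bound on the average of the state powers, replaces the concavity
of the logarithm (`sum_gaussian_le`). The last noise has its own variance parameter; for a uniform
one the deficit `log (2πe σv'²) - 2 log (2 σv') = log (πe/2)` of its entropy is what distinguishes
the third bound from the second.
-/

namespace StateAmplification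

/-! ### Measures on finite products -/

theorem lintegral_pi_prod {k : ℕ} (μ : Fin k → Measure ℝ) [∀ i, SigmaFinite (μ i)]
    {p : Fin k → ℝ → ENNReal} (hp : ∀ i, Measurable (p i)) :
    ∫⁻ u, ∏ i, p i (u i) ∂(Measure.pi μ) = ∏ i, ∫⁻ z, p i z ∂(μ i) := by
  induction k with
  | zero => simp
  | succ n ih =>
    have hm : Measurable fun u : Fin n → ℝ => ∏ i, p (Fin.succ i) (u i) :=
      Finset.measurable_prod _ fun i _ => (hp _).comp (measurable_pi_apply i)
    rw [← (measurePreserving_piFinSuccAbove μ 0).symm.lintegral_comp_emb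
      (MeasurableEquiv.measurableEmbedding _)]
    simp_rw [MeasurableEquiv.piFinSuccAbove_symm_apply, Fin.insertNthEquiv,
      Fin.prod_univ_succ, Equiv.coe_fn_mk, Fin.insertNth_zero, Fin.cons_zero, Fin.cons_succ,
      Fin.zero_succAbove, cast_eq]
    rw [lintegral_prod_mul (f := p 0) (g := fun u : Fin n → ℝ => ∏ i, p (Fin.succ i) (u i))
      (hp 0).aemeasurable hm.aemeasurable]
    congr 1
    exact ih _ fun i => hp _

theorem pi_withDensity {k : ℕ} {ρ : Fin k → ℝ → ENNReal} (hρ : ∀ i, Measurable (ρ i))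
    [∀ i, SigmaFinite ((volume : Measure ℝ).withDensity (ρ i))] :
    Measure.pi (fun i => (volume : Measure ℝ).withDensity (ρ i)) =
      (volume : Measure (Fin k → ℝ)).withDensity fun u => ∏ i, ρ i (u i) := by
  refine Measure.pi_eq fun s hs => ?_
  rw [withDensity_apply _ (MeasurableSet.univ_pi hs), volume_pi, Measure.restrict_pi_pi,
    lintegral_pi_prod _ hρ]
  exact Finset.prod_congr rfl fun i _ => (withDensity_apply _ (hs i)).symm

/-! ### Causal shifts -/

/-- The extension by zero of a finite sequence, which allows functions of the whole noise sequence
to be evaluated on the finitely many noises that matter; the values beyond them are irrelevant to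
causal functions. -/
def extendZero {k : ℕ} (u : Fin k → ℝ) (n : ℕ) : ℝ :=
  if h : n < k then u ⟨n, h⟩ else 0

@[simp]
theorem extendZero_val {k : ℕ} (u : Fin k → ℝ) (i : Fin k) : extendZero u i = u i := by
  simp [extendZero]

theorem extendZero_of_lt {k n : ℕ} (u : Fin k → ℝ) (h : n < k) : extendZero u n = u ⟨n, h⟩ := by
  simp [extendZero, h]

theorem measurable_extendZero {k : ℕ} :
    Measurable (extendZero : (Fin k → ℝ) → ℕ → ℝ) := by
  refine measurable_pi_lambda _ fun n => ?_
  unfold extendZero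
  split_ifs with h
  · exact measurable_pi_apply _
  · exact measurable_const

/-- Adding to each coordinate a function of the earlier coordinates is a shear, so it preserves
Lebesgue measure. -/
theorem measurePreserving_causalShift {s : ℕ → (ℕ → ℝ) → ℝ} (hs : ∀ n, Measurable (s n))
    (hcausal : ∀ n v v', (∀ j < n, v j = v' j) → s n v = s n v') (k : ℕ) :
    MeasurePreserving (fun (u : Fin k → ℝ) (i : Fin k) => s i (extendZero u) + u i) := by
  induction k with
  | zero =>
    have h : (fun (u : Fin 0 → ℝ) (i : Fin 0) => s i (extendZero u) + u i) = id :=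
      funext fun u => Subsingleton.elim _ _
    exact h ▸ MeasurePreserving.id _
  | succ n ih =>
    have e := volume_preserving_piFinSuccAbove (fun _ : Fin (n + 1) => ℝ) (Fin.last n)
    have hskew : MeasurePreserving (fun q : (Fin n → ℝ) × ℝ =>
        ((fun (i : Fin n) => s i (extendZero q.1) + q.1 i), s n (extendZero q.1) + q.2))
        (volume.prod volume) (volume.prod volume) := by
      refine ih.skew_product (g := fun u z => s n (extendZero u) + z) ?_ ?_
      · exact (((hs n).comp measurable_extendZero).comp measurable_fst).add measurable_snd
      · exact Filter.Eventually.of_forall fun u => (measurePreserving_add_left volume _).map_eq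
    have h := e.symm.comp (Measure.measurePreserving_swap.comp
      (hskew.comp (Measure.measurePreserving_swap.comp e)))
    -- `h` splits off the last coordinate; neither the last nor an earlier shift depends on it
    convert h using 1
    ext u i
    refine Fin.lastCases ?_ (fun j => ?_) i
    · simp [MeasurableEquiv.piFinSuccAbove, Fin.insertNthEquiv]
      refine hcausal _ _ _ fun j hj => ?_
      rw [extendZero_of_lt _ hj, extendZero_of_lt _ (hj.trans (Nat.lt_succ_self n))]
      rfl
    · simp [MeasurableEquiv.piFinSuccAbove, Fin.insertNthEquiv]
      refine congrArg (· + _) (hcausal _ _ _ fun j' hj' => ?_)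
      have h2 : j' < n := hj'.trans j.2
      rw [extendZero_of_lt _ h2, extendZero_of_lt _ (h2.trans (Nat.lt_succ_self n))]
      rfl

/-! ### Gibbs' inequality -/

/-- Gibbs' inequality: if `P` has a density at most `exp ℓ`, then the expectation of the logarithm
of a subprobability density is at most that of `ℓ`. -/
theorem integral_log_le_of_lintegral_exp_le_one {α : Type*} [MeasurableSpace α]
    {P r : Measure α} [IsProbabilityMeasure P] {h l : α → ℝ} (hl : Measurable l)
    (hh : Measurable h)
    (hP : P ≤ r.withDensity fun z => ENNReal.ofReal (Real.exp (l z)))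
    (hone : ∫⁻ z, ENNReal.ofReal (Real.exp (h z)) ∂r ≤ 1)
    (hhi : Integrable h P) (hli : Integrable l P) : ∫ z, h z ∂P ≤ ∫ z, l z ∂P := by
  have hle : ∫⁻ z, ENNReal.ofReal (Real.exp (h z - l z)) ∂P ≤ 1 := by
    refine (lintegral_mono' hP le_rfl).trans ?_
    rw [lintegral_withDensity_eq_lintegral_mul _ (by fun_prop) (by fun_prop)]
    refine le_of_eq_of_le (lintegral_congr fun z => ?_) hone
    rw [Pi.mul_apply, ← ENNReal.ofReal_mul (Real.exp_pos _).le, ← Real.exp_add,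
      add_sub_cancel]
  have hint : Integrable (fun z => Real.exp (h z - l z)) P := by
    refine ⟨by fun_prop, ?_⟩
    rw [hasFiniteIntegral_iff_ofReal (Filter.Eventually.of_forall fun z => (Real.exp_pos _).le)]
    exact hle.trans_lt ENNReal.one_lt_top
  have h1 : ∫ z, Real.exp (h z - l z) ∂P ≤ 1 := by
    rw [integral_eq_lintegral_of_nonneg_ae
      (Filter.Eventually.of_forall fun z => (Real.exp_pos _).le) hint.aestronglyMeasurable]
    exact ENNReal.toReal_mono ENNReal.one_ne_top hle
  have h2 : ∫ z, (h z - l z + 1) ∂P ≤ ∫ z, Real.exp (h z - l z) ∂P :=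
    integral_mono ((hhi.sub hli).add (integrable_const 1)) hint fun z => Real.add_one_le_exp _
  rw [integral_add (f := fun z => h z - l z) (hhi.sub hli) (integrable_const 1),
    integral_sub hhi hli, integral_const, probReal_univ, one_smul] at h2
  linarith

/-! ### The comparison density -/

/-- If `u ↦ y (x, u)` preserves Lebesgue measure for each `x`, then the product of the densities
`p i` at the coordinates of `y` and of the density `q` at the error `x - g y` is a probability
density in `(x, u)`: after the change of variables one integrates over `x` first. -/
theorem lintegral_comparison_eq_one {k : ℕ} {y : ℝ × (Fin k → ℝ) → Fin k → ℝ} (hy : Measurable y)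
    (hmp : ∀ x, MeasurePreserving fun u => y (x, u)) {g : (Fin k → ℝ) → ℝ} (hg : Measurable g)
    {p : Fin k → ℝ → ENNReal} (hp : ∀ i, Measurable (p i)) (hp1 : ∀ i, ∫⁻ z, p i z = 1)
    {q : ℝ → ENNReal} (hq : Measurable q) (hq1 : ∫⁻ z, q z = 1) :
    ∫⁻ z : ℝ × (Fin k → ℝ), (∏ i, p i (y z i)) * q (z.1 - g (y z)) = 1 := by
  have hpm : Measurable fun t : Fin k → ℝ => ∏ i, p i (t i) :=
    Finset.measurable_prod _ fun i _ => (hp i).comp (measurable_pi_apply i)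
  have hF : Measurable fun z : ℝ × (Fin k → ℝ) => (∏ i, p i (z.2 i)) * q (z.1 - g z.2) :=
    (hpm.comp measurable_snd).mul (hq.comp (measurable_fst.sub (hg.comp measurable_snd)))
  have hF' : Measurable fun z : ℝ × (Fin k → ℝ) => (∏ i, p i (y z i)) * q (z.1 - g (y z)) :=
    hF.comp (measurable_fst.prodMk hy)
  rw [Measure.volume_eq_prod, lintegral_prod _ hF'.aemeasurable]
  have hstep : ∀ x : ℝ, ∫⁻ u, (∏ i, p i (y (x, u) i)) * q (x - g (y (x, u))) =
      ∫⁻ t : Fin k → ℝ, (∏ i, p i (t i)) * q (x - g t) := fun x =>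
    (hmp x).lintegral_comp (f := fun t : Fin k → ℝ => (∏ i, p i (t i)) * q (x - g t))
      (hF.comp (measurable_const.prodMk measurable_id))
  simp_rw [hstep]
  rw [lintegral_lintegral_swap hF.aemeasurable]
  have hx : ∀ t : Fin k → ℝ, ∫⁻ x : ℝ, (∏ i, p i (t i)) * q (x - g t) = ∏ i, p i (t i) := by
    intro t
    rw [lintegral_const_mul _ (by fun_prop), lintegral_sub_right_eq_self q, hq1, mul_one]
  simp_rw [hx]
  rw [volume_pi, lintegral_pi_prod _ hp]
  simp [hp1]

/-! ### Gaussian and uniform noise -/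

/-- The logarithm of the density of the centred Gaussian law with variance `t`. -/
noncomputable def gaussianLogDensity (t z : ℝ) : ℝ :=
  -(1 / 2) * Real.log (2 * Real.pi * t) - z ^ 2 / (2 * t)

theorem measurable_gaussianLogDensity (t : ℝ) : Measurable (gaussianLogDensity t) := by
  unfold gaussianLogDensity
  fun_prop

theorem exp_gaussianLogDensity {t : ℝ} (ht : 0 < t) (z : ℝ) :
    ENNReal.ofReal (Real.exp (gaussianLogDensity t z)) = gaussianPDF 0 t.toNNReal z := by
  have h : 0 < 2 * Real.pi * t := by positivity
  rw [gaussianPDF_def, gaussianPDFReal_def, gaussianLogDensity, Real.coe_toNNReal _ ht.le,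
    sub_eq_add_neg, Real.exp_add, Real.sqrt_eq_rpow, ← Real.rpow_neg h.le,
    Real.rpow_def_of_pos h, mul_comm (Real.log _)]
  simp only [sub_zero, neg_div]

theorem lintegral_exp_gaussianLogDensity {t : ℝ} (ht : 0 < t) :
    ∫⁻ z, ENNReal.ofReal (Real.exp (gaussianLogDensity t z)) = 1 := by
  simp_rw [exp_gaussianLogDensity ht]
  exact lintegral_gaussianPDF_eq_one _ (by simpa using ht)

theorem integral_sq_gaussianReal {t : ℝ} (ht : 0 ≤ t) :
    ∫ z, z ^ 2 ∂gaussianReal 0 t.toNNReal = t := by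
  have h := variance_fun_id_gaussianReal (μ := 0) (v := t.toNNReal)
  rw [variance_eq_integral measurable_id'.aemeasurable] at h
  simpa [ht] using h

theorem integrable_sq_gaussianReal (t : ℝ) :
    Integrable (fun z => z ^ 2) (gaussianReal 0 t.toNNReal) :=
  (memLp_id_gaussianReal' 2 (by simp)).integrable_sq

theorem integrable_gaussianLogDensity (t : ℝ) :
    Integrable (gaussianLogDensity t) (gaussianReal 0 t.toNNReal) :=
  (integrable_const _).sub ((integrable_sq_gaussianReal t).div_const _)

theorem integral_gaussianLogDensity {t : ℝ} (ht : 0 < t) :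
    ∫ z, gaussianLogDensity t z ∂gaussianReal 0 t.toNNReal =
      -((Real.log (2 * Real.pi * t) + 1) / 2) := by
  simp only [gaussianLogDensity]
  rw [integral_sub (integrable_const _) ((integrable_sq_gaussianReal t).div_const _),
    integral_div, integral_sq_gaussianReal ht.le, integral_const, probReal_univ, one_smul]
  field_simp
  ring

/-- `ν` is the law of a centred noise with second moment `m`, whose density is dominated by some
`exp ℓ` with `∫ ℓ dν = -h`; the natural choice is the logarithm `ℓ` of the density, for which
`h` is the differential entropy of `ν` in nats. A bound by `exp ℓ` rather than equality lets `ℓ`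
be finite outside the support of `ν`. -/
structure IsCentredNoise (ν : Measure ℝ) (h m : ℝ) : Prop where
  prob : IsProbabilityMeasure ν
  density : ∃ (ρ : ℝ → ENNReal) (l : ℝ → ℝ), Measurable ρ ∧ Measurable l ∧
    ν = volume.withDensity ρ ∧ (∀ z, ρ z ≤ ENNReal.ofReal (Real.exp (l z))) ∧
    Integrable l ν ∧ ∫ z, l z ∂ν = -h
  memLp : MemLp id 2 ν
  mean : ∫ z, z ∂ν = 0
  second_moment : ∫ z, z ^ 2 ∂ν = m

theorem isCentredNoise_gaussianReal {t : ℝ} (ht : 0 < t) :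
    IsCentredNoise (gaussianReal 0 t.toNNReal) ((Real.log (2 * Real.pi * t) + 1) / 2) t where
  prob := inferInstance
  density := ⟨gaussianPDF 0 t.toNNReal, gaussianLogDensity t, measurable_gaussianPDF _ _,
    measurable_gaussianLogDensity t, gaussianReal_of_var_ne_zero _ (by simpa using ht),
    fun z => (exp_gaussianLogDensity ht z).ge, integrable_gaussianLogDensity t,
    integral_gaussianLogDensity ht⟩
  memLp := memLp_id_gaussianReal' 2 (by simp)
  mean := integral_id_gaussianReal
  second_moment := integral_sq_gaussianReal ht.le

theorem integral_uniformNoise {s : ℝ} (hs : 0 < s) (F : ℝ → ℝ) :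
    ∫ z, F z ∂uniformNoise s = (2 * s)⁻¹ * ∫ z in -s..s, F z := by
  rw [uniformNoise, ProbabilityTheory.cond, integral_smul_measure, Real.volume_Icc,
    intervalIntegral.integral_of_le (by linarith), integral_Icc_eq_integral_Ioc, smul_eq_mul,
    ENNReal.toReal_inv, ENNReal.toReal_ofReal (by linarith)]
  ring

theorem isCentredNoise_uniformNoise {s : ℝ} (hs : 0 < s) :
    IsCentredNoise (uniformNoise s) (Real.log (2 * s)) (s ^ 2 / 3) := by
  have hvol : volume (Set.Icc (-s) s) = ENNReal.ofReal (2 * s) := by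
    rw [Real.volume_Icc]
    ring_nf
  have hprob : IsProbabilityMeasure (uniformNoise s) :=
    cond_isProbabilityMeasure_of_finite (by rw [hvol]; simpa using hs)
      (by rw [hvol]; exact ENNReal.ofReal_ne_top)
  have hdens : uniformNoise s = volume.withDensity
      ((Set.Icc (-s) s).indicator fun _ => ENNReal.ofReal (2 * s)⁻¹) := by
    rw [withDensity_indicator measurableSet_Icc, withDensity_const, uniformNoise,
      ProbabilityTheory.cond, hvol, ENNReal.ofReal_inv_of_pos (by linarith)]
  refine ⟨hprob, ⟨_, fun _ => -Real.log (2 * s), ?_, measurable_const, hdens, fun z => ?_,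
    ?_, by simp⟩, ?_, ?_, ?_⟩
  · exact measurable_const.indicator measurableSet_Icc
  · rw [Real.exp_neg, Real.exp_log (by linarith)]
    exact Set.indicator_le_self _ _ z
  · exact integrable_const (μ := uniformNoise s) _
  · refine MemLp.of_bound (by fun_prop) s ?_
    rw [uniformNoise, ProbabilityTheory.cond]
    refine Measure.ae_smul_measure ?_ _
    filter_upwards [ae_restrict_mem measurableSet_Icc] with z hz
    exact abs_le.2 hz
  · rw [integral_uniformNoise hs, integral_id]
    ring
  · rw [integral_uniformNoise hs, integral_pow]
    field_simp
    norm_num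
    ring

/-! ### The entropy inequality of the channel -/

/-- If the source and the noises are independent and, given the source, the output `y` is a
measure-preserving function of the noises, then the output powers `Y i` and the mean square error
`D` of any estimator satisfy the converse bound; `τ i` are the variances of the Gaussian
reference laws of the outputs. -/
theorem log_div_le_sum {k : ℕ} {σ₀ D : ℝ} (hσ₀ : 0 < σ₀) (hD : 0 < D) {τ h m Y : Fin k → ℝ}
    (hτ : ∀ i, 0 < τ i) {ν : Fin k → Measure ℝ} (hν : ∀ i, IsCentredNoise (ν i) (h i) (m i))
    {y : ℝ × (Fin k → ℝ) → Fin k → ℝ} (hy : Measurable y)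
    (hmp : ∀ x, MeasurePreserving fun u => y (x, u)) {g : (Fin k → ℝ) → ℝ} (hg : Measurable g)
    (hyi : ∀ i, Integrable (fun z => y z i ^ 2)
      ((gaussianReal 0 (σ₀ ^ 2).toNNReal).prod (Measure.pi ν)))
    (hY : ∀ i, ∫ z, y z i ^ 2 ∂((gaussianReal 0 (σ₀ ^ 2).toNNReal).prod (Measure.pi ν)) ≤ Y i)
    (herr : Integrable (fun z => (z.1 - g (y z)) ^ 2)
      ((gaussianReal 0 (σ₀ ^ 2).toNNReal).prod (Measure.pi ν)))
    (hle : ∫ z, (z.1 - g (y z)) ^ 2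
      ∂((gaussianReal 0 (σ₀ ^ 2).toNNReal).prod (Measure.pi ν)) ≤ D) :
    Real.log (σ₀ ^ 2) - Real.log D ≤
      ∑ i, (Real.log (2 * Real.pi * τ i) + Y i / τ i - 2 * h i) := by
  have hprob : ∀ i, IsProbabilityMeasure (ν i) := fun i => (hν i).prob
  choose ρ l hρ hl hνρ hρl hli hlint using fun i => (hν i).density
  have hsf : ∀ i, SigmaFinite ((volume : Measure ℝ).withDensity (ρ i)) := fun i => by
    rw [← hνρ i]
    infer_instance
  have hσ : 0 < σ₀ ^ 2 := by positivity
  set P := (gaussianReal 0 (σ₀ ^ 2).toNNReal).prod (Measure.pi ν) with hPdef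
  -- the logarithm of (a bound on) the density of the source and the noises
  let L : ℝ × (Fin k → ℝ) → ℝ := fun z =>
    gaussianLogDensity (σ₀ ^ 2) z.1 + ∑ i, l i (z.2 i)
  -- the logarithm of the comparison density
  let H : ℝ × (Fin k → ℝ) → ℝ := fun z =>
    (∑ i, gaussianLogDensity (τ i) (y z i)) + gaussianLogDensity D (z.1 - g (y z))
  have hG : ∀ t, Measurable (gaussianLogDensity t) := measurable_gaussianLogDensity
  have hyc : ∀ i, Measurable fun z => y z i := fun i => (measurable_pi_apply i).comp hy
  have hLm : Measurable L := ((hG _).comp measurable_fst).add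
    (Finset.measurable_sum _ fun i _ =>
      (hl i).comp ((measurable_pi_apply i).comp measurable_snd))
  have hHm : Measurable H := (Finset.measurable_sum _ fun i _ => (hG _).comp (hyc i)).add
    ((hG _).comp (measurable_fst.sub (hg.comp hy)))
  have hdom : P ≤ volume.withDensity fun z => ENNReal.ofReal (Real.exp (L z)) := by
    have hpi : Measure.pi ν = volume.withDensity fun u => ∏ i, ρ i (u i) := by
      rw [← pi_withDensity hρ]
      exact congrArg Measure.pi (funext hνρ)
    rw [hPdef, hpi, gaussianReal_of_var_ne_zero _ (by simpa using hσ₀.ne'),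
      prod_withDensity (measurable_gaussianPDF _ _)
        (g := fun u : Fin k → ℝ => ∏ i, ρ i (u i))
        (Finset.measurable_prod _ fun i _ => (hρ i).comp (measurable_pi_apply i))]
    refine withDensity_mono (Filter.Eventually.of_forall fun z => ?_)
    simp only [L]
    rw [Real.exp_add, Real.exp_sum, ENNReal.ofReal_mul (Real.exp_pos _).le,
      exp_gaussianLogDensity hσ, ENNReal.ofReal_prod_of_nonneg fun i _ => (Real.exp_pos _).le]
    gcongr
    exact hρl _ _
  have hone : ∫⁻ z, ENNReal.ofReal (Real.exp (H z)) ≤ 1 := by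
    rw [← lintegral_comparison_eq_one hy hmp hg
      (p := fun i z => ENNReal.ofReal (Real.exp (gaussianLogDensity (τ i) z)))
      (fun i => ((hG _).exp).ennreal_ofReal)
      (fun i => lintegral_exp_gaussianLogDensity (hτ i))
      (q := fun z => ENNReal.ofReal (Real.exp (gaussianLogDensity D z)))
      ((hG _).exp).ennreal_ofReal (lintegral_exp_gaussianLogDensity hD)]
    refine le_of_eq (lintegral_congr fun z => ?_)
    simp only [H]
    rw [Real.exp_add, Real.exp_sum, ENNReal.ofReal_mul (by positivity),
      ENNReal.ofReal_prod_of_nonneg fun i _ => (Real.exp_pos _).le]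
  have hLi : ∀ i, Integrable (fun z : ℝ × (Fin k → ℝ) => l i (z.2 i)) P := fun i =>
    (((measurePreserving_eval ν i).comp measurePreserving_snd).integrable_comp
      (hl i).aestronglyMeasurable).2 (hli i)
  have hL1 : Integrable (fun z : ℝ × (Fin k → ℝ) => gaussianLogDensity (σ₀ ^ 2) z.1) P :=
    (measurePreserving_fst.integrable_comp (hG _).aestronglyMeasurable).2
      (integrable_gaussianLogDensity _)
  have hLI : ∫ z, L z ∂P =
      -((Real.log (2 * Real.pi * σ₀ ^ 2) + 1) / 2) + ∑ i, -h i := by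
    simp only [L]
    rw [integral_add hL1 (integrable_finsetSum _ fun i _ => hLi i),
      integral_finsetSum _ fun i _ => hLi i]
    congr 1
    · rw [← integral_gaussianLogDensity hσ]
      exact integral_map measurable_fst.aemeasurable (hG _).aestronglyMeasurable |>.symm.trans
        (by rw [measurePreserving_fst.map_eq])
    · refine Finset.sum_congr rfl fun i _ => ?_
      have e := (measurePreserving_eval ν i).comp
        (measurePreserving_snd (μ := gaussianReal 0 (σ₀ ^ 2).toNNReal) (ν := Measure.pi ν))
      rw [← hlint i, ← e.map_eq, integral_map e.measurable.aemeasurable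
        (hl i).aestronglyMeasurable]
      rfl
  have hquad : ∀ (t : ℝ) (F : ℝ × (Fin k → ℝ) → ℝ), Integrable (fun z => F z ^ 2) P →
      Integrable (fun z => gaussianLogDensity t (F z)) P ∧
      ∫ z, gaussianLogDensity t (F z) ∂P =
        -(1 / 2) * Real.log (2 * Real.pi * t) - (∫ z, F z ^ 2 ∂P) / (2 * t) := by
    intro t F hF
    refine ⟨(integrable_const _).sub (hF.div_const _), ?_⟩
    simp only [gaussianLogDensity]
    rw [integral_sub (integrable_const _) (hF.div_const _), integral_div, integral_const,
      probReal_univ, one_smul]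
  have hHI : ∫ z, H z ∂P = (∑ i, (-(1 / 2) * Real.log (2 * Real.pi * τ i) -
        (∫ z, y z i ^ 2 ∂P) / (2 * τ i))) +
      (-(1 / 2) * Real.log (2 * Real.pi * D) - (∫ z, (z.1 - g (y z)) ^ 2 ∂P) / (2 * D)) := by
    simp only [H]
    rw [integral_add (integrable_finsetSum _ fun i _ => (hquad _ _ (hyi i)).1)
      (hquad _ _ herr).1, integral_finsetSum _ fun i _ => (hquad _ _ (hyi i)).1,
      (hquad _ _ herr).2]
    exact congrArg (· + _) (Finset.sum_congr rfl fun i _ => (hquad _ _ (hyi i)).2)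
  have hgibbs := integral_log_le_of_lintegral_exp_le_one hLm hHm hdom hone
    ((integrable_finsetSum _ fun i _ => (hquad _ _ (hyi i)).1).add (hquad _ _ herr).1)
    (hL1.add (integrable_finsetSum _ fun i _ => hLi i))
  rw [hHI, hLI] at hgibbs
  have hπ : 0 < 2 * Real.pi := by positivity
  rw [Real.log_mul hπ.ne' hσ.ne', Real.log_mul hπ.ne' hD.ne'] at hgibbs
  have hlast : (∫ z, (z.1 - g (y z)) ^ 2 ∂P) / (2 * D) ≤ 1 / 2 := by
    rw [div_le_div_iff₀ (by positivity) (by positivity)]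
    linarith
  have hsum : ∑ i, (-(1 / 2) * (Real.log (2 * Real.pi * τ i) + Y i / τ i - 2 * h i)) ≤
      (∑ i, (-(1 / 2) * Real.log (2 * Real.pi * τ i) - (∫ z, y z i ^ 2 ∂P) / (2 * τ i))) -
        ∑ i, -h i := by
    rw [← Finset.sum_sub_distrib]
    refine Finset.sum_le_sum fun i _ => ?_
    have hi : (∫ z, y z i ^ 2 ∂P) / (2 * τ i) ≤ 1 / 2 * (Y i / τ i) := by
      have h2 : 1 / 2 * (Y i / τ i) = Y i / (2 * τ i) := by ring
      rw [h2]
      exact div_le_div_of_nonneg_right (hY i) (by linarith [hτ i])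
    linarith
  rw [← Finset.mul_sum] at hsum
  linarith

/-! ### The part of the observation that precedes the noise -/

/-- The state `aⁿ x + ∑_{i < n} a^{n-1-i} u[i]` that is observed at time `n` through noise. -/
noncomputable def state (a : ℝ) (f : (n : ℕ) → ℝ → (Fin n → ℝ) → ℝ) (x : ℝ) (v : ℕ → ℝ)
    (n : ℕ) : ℝ :=
  a ^ n * x + ∑ i ∈ Finset.range n, a ^ (n - 1 - i) * input f x v i

theorem observation_eq (a : ℝ) (f : (n : ℕ) → ℝ → (Fin n → ℝ) → ℝ) (x : ℝ) (v : ℕ → ℝ) (n : ℕ) :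
    observation a f x v n = state a f x v n + v n := rfl

section Causal

variable {a : ℝ} {f : (n : ℕ) → ℝ → (Fin n → ℝ) → ℝ}

theorem input_congr {x : ℝ} {n : ℕ} {v v' : ℕ → ℝ} (h : ∀ j < n, v j = v' j) :
    input f x v n = input f x v' n :=
  congrArg (f n x) (funext fun j => h j j.2)

theorem state_congr {x : ℝ} {n : ℕ} {v v' : ℕ → ℝ} (h : ∀ j < n, v j = v' j) :
    state a f x v n = state a f x v' n :=
  congrArg (a ^ n * x + ·) <| Finset.sum_congr rfl fun i hi =>
    congrArg (a ^ (n - 1 - i) * ·) <|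
      input_congr fun j hj => h j (hj.trans (Finset.mem_range.1 hi))

theorem measurable_input (hf : ∀ n, Measurable fun p : ℝ × (Fin n → ℝ) => f n p.1 p.2) (n : ℕ) :
    Measurable fun p : ℝ × (ℕ → ℝ) => input f p.1 p.2 n :=
  (hf n).comp (measurable_fst.prodMk (measurable_pi_lambda _ fun j =>
    (measurable_pi_apply (j : ℕ)).comp measurable_snd))

theorem measurable_state (hf : ∀ n, Measurable fun p : ℝ × (Fin n → ℝ) => f n p.1 p.2) (n : ℕ) :
    Measurable fun p : ℝ × (ℕ → ℝ) => state a f p.1 p.2 n :=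
  (measurable_fst.const_mul _).add
    (Finset.measurable_sum _ fun i _ => (measurable_input hf i).const_mul _)

end Causal

/-! ### The power of the state -/

/-- By the Cauchy–Schwarz inequality with the weights `wⁱ`, the square of the state is at most
`a²ⁿ` times a bound that depends only on the source and the discounted input energy. -/
theorem state_sq_le {a w : ℝ} (ha : a ≠ 0) (hw : 0 < w) (haw : 1 / (a ^ 2 * w) < 1)
    (f : (n : ℕ) → ℝ → (Fin n → ℝ) → ℝ) (x : ℝ) (v : ℕ → ℝ) (n : ℕ) :
    state a f x v n ^ 2 ≤ a ^ (2 * n) * (2 * x ^ 2 + 2 * ((a ^ 2)⁻¹ / (1 - 1 / (a ^ 2 * w)) *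
      ∑ i ∈ Finset.range n, w ^ i * input f x v i ^ 2)) := by
  have ha2 : 0 < a ^ 2 := by positivity
  set r := 1 / (a ^ 2 * w) with hr
  have hr0 : 0 ≤ r := by positivity
  set u := input f x v
  have han : 0 ≤ a ^ (2 * n) := by
    rw [pow_mul]
    positivity
  have hcs : (∑ i ∈ Finset.range n, a ^ (n - 1 - i) * u i) ^ 2 ≤
      (∑ i ∈ Finset.range n, a ^ (2 * n) * (a ^ 2)⁻¹ * r ^ i) *
        ∑ i ∈ Finset.range n, w ^ i * u i ^ 2 := by
    refine Finset.sum_sq_le_sum_mul_sum_of_sq_le_mul _ (fun i _ => by positivity)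
      (fun i _ => by positivity) fun i hi => le_of_eq ?_
    obtain ⟨j, rfl⟩ : ∃ j, n = i + 1 + j := ⟨n - (i + 1), by
      have := Finset.mem_range.1 hi
      omega⟩
    have hj : i + 1 + j - 1 - i = j := by omega
    rw [hj, hr, one_div, inv_pow, mul_pow]
    field_simp
    ring
  have hgeom : ∑ i ∈ Finset.range n, a ^ (2 * n) * (a ^ 2)⁻¹ * r ^ i ≤
      a ^ (2 * n) * (a ^ 2)⁻¹ * (1 - r)⁻¹ := by
    rw [← Finset.mul_sum]
    refine mul_le_mul_of_nonneg_left ?_ (by positivity)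
    rw [← tsum_geometric_of_lt_one hr0 haw]
    exact (summable_geometric_of_lt_one hr0 haw).sum_le_tsum _ fun i _ => by positivity
  have hE : 0 ≤ ∑ i ∈ Finset.range n, w ^ i * u i ^ 2 :=
    Finset.sum_nonneg fun i _ => by positivity
  calc state a f x v n ^ 2
      ≤ 2 * ((a ^ n * x) ^ 2 + (∑ i ∈ Finset.range n, a ^ (n - 1 - i) * u i) ^ 2) := add_sq_le
    _ ≤ 2 * ((a ^ n * x) ^ 2 + a ^ (2 * n) * (a ^ 2)⁻¹ * (1 - r)⁻¹ *
          ∑ i ∈ Finset.range n, w ^ i * u i ^ 2) := by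
        gcongr
        exact hcs.trans (mul_le_mul_of_nonneg_right hgeom hE)
    _ = _ := by ring

section Probability

variable {Ω : Type*} [MeasurableSpace Ω] {μ : Measure Ω}

theorem memLp_two_of_secondMoment_ne_top {X : Ω → ℝ} (hX : AEMeasurable X μ)
    (h : secondMoment μ X ≠ ⊤) : MemLp X 2 μ := by
  rw [memLp_two_iff_integrable_sq hX.aestronglyMeasurable]
  refine ⟨(hX.pow_const 2).aestronglyMeasurable, ?_⟩
  rw [hasFiniteIntegral_iff_ofReal (Filter.Eventually.of_forall fun _ => sq_nonneg _)]
  exact lt_top_iff_ne_top.2 h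

theorem secondMoment_eq_ofReal {X : Ω → ℝ} (hX : MemLp X 2 μ) :
    secondMoment μ X = ENNReal.ofReal (∫ ω, X ω ^ 2 ∂μ) :=
  (ofReal_integral_eq_lintegral_ofReal hX.integrable_sq
    (Filter.Eventually.of_forall fun _ => sq_nonneg _)).symm

/-- The factor `2 σ₀² + 2 a⁻² P / ((1 - 1/(a² w)) (1 - w))` of `a²ⁿ` in the bound on the power of
the state at time `n`. -/
noncomputable def powerFactor (a w σ₀ P : ℝ) : ℝ :=
  2 * σ₀ ^ 2 + 2 * ((a ^ 2)⁻¹ / (1 - 1 / (a ^ 2 * w)) * (P / (1 - w)))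

theorem powerFactor_nonneg {a w σ₀ P : ℝ} (hw1 : w < 1) (haw : 1 / (a ^ 2 * w) < 1)
    (hP : 0 ≤ P) : 0 ≤ powerFactor a w σ₀ P := by
  have h1 : 0 < 1 - w := by linarith
  have h2 : 0 < 1 - 1 / (a ^ 2 * w) := by linarith
  unfold powerFactor
  positivity

variable {k : ℕ} {a w σ₀ P : ℝ} {f : (n : ℕ) → ℝ → (Fin n → ℝ) → ℝ} {x₀ : Ω → ℝ} {v : ℕ → Ω → ℝ}

theorem aemeasurable_input (hf : ∀ n, Measurable fun p : ℝ × (Fin n → ℝ) => f n p.1 p.2)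
    (hx : AEMeasurable x₀ μ) (hv : ∀ n < k, AEMeasurable (v n) μ) {n : ℕ} (hn : n ≤ k) :
    AEMeasurable (fun ω => input f (x₀ ω) (fun j => v j ω) n) μ :=
  (hf n).comp_aemeasurable (hx.prodMk (aemeasurable_pi_lambda _ fun j => hv j (j.2.trans_le hn)))

theorem memLp_input (hw0 : 0 < w) (hw1 : w < 1)
    (hf : ∀ n, Measurable fun p : ℝ × (Fin n → ℝ) => f n p.1 p.2)
    (hx : AEMeasurable x₀ μ) (hv : ∀ n < k, AEMeasurable (v n) μ)
    (hpower : discountedPower μ k w f x₀ v ≤ ENNReal.ofReal P) {n : ℕ} (hn : n < k - 1) :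
    MemLp (fun ω => input f (x₀ ω) (fun j => v j ω) n) 2 μ := by
  refine memLp_two_of_secondMoment_ne_top (aemeasurable_input hf hx hv (by omega)) fun htop => ?_
  have h1 := (Finset.single_le_sum (f := fun n => ENNReal.ofReal ((1 - w) * w ^ n) *
    secondMoment μ fun ω => input f (x₀ ω) (fun j => v j ω) n) (fun _ _ => zero_le)
    (Finset.mem_range.2 hn)).trans hpower
  have h2 : 0 < (1 - w) * w ^ n := mul_pos (by linarith) (pow_pos hw0 n)
  simp only [htop] at h1
  rw [ENNReal.mul_top (by simpa using h2)] at h1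
  exact ENNReal.ofReal_ne_top (top_le_iff.1 h1)

theorem sum_integral_input_sq_le (hw0 : 0 < w) (hw1 : w < 1) (hP : 0 ≤ P)
    (hf : ∀ n, Measurable fun p : ℝ × (Fin n → ℝ) => f n p.1 p.2)
    (hx : AEMeasurable x₀ μ) (hv : ∀ n < k, AEMeasurable (v n) μ)
    (hpower : discountedPower μ k w f x₀ v ≤ ENNReal.ofReal P) :
    ∑ i ∈ Finset.range (k - 1), w ^ i * ∫ ω, input f (x₀ ω) (fun j => v j ω) i ^ 2 ∂μ ≤
      P / (1 - w) := by
  have h1w : 0 < 1 - w := by linarith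
  rw [le_div_iff₀ h1w, Finset.sum_mul, ← ENNReal.ofReal_le_ofReal_iff hP]
  refine le_of_eq_of_le ?_ hpower
  rw [ENNReal.ofReal_sum_of_nonneg fun i _ => by positivity]
  refine Finset.sum_congr rfl fun i hi => ?_
  rw [secondMoment_eq_ofReal (memLp_input hw0 hw1 hf hx hv hpower (Finset.mem_range.1 hi)),
    ← ENNReal.ofReal_mul (by positivity)]
  congr 1
  ring

theorem memLp_state (hw0 : 0 < w) (hw1 : w < 1)
    (hf : ∀ n, Measurable fun p : ℝ × (Fin n → ℝ) => f n p.1 p.2)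
    (hx : MemLp x₀ 2 μ) (hv : ∀ n < k, AEMeasurable (v n) μ)
    (hpower : discountedPower μ k w f x₀ v ≤ ENNReal.ofReal P) {n : ℕ} (hn : n < k) :
    MemLp (fun ω => state a f (x₀ ω) (fun j => v j ω) n) 2 μ :=
  (hx.const_mul _).add <| memLp_finsetSum _ fun i hi =>
    (memLp_input hw0 hw1 hf hx.aestronglyMeasurable.aemeasurable hv hpower
      (by have := Finset.mem_range.1 hi; omega)).const_mul _

theorem integral_state_sq_le (ha : a ≠ 0) (hw0 : 0 < w) (hw1 : w < 1)
    (haw : 1 / (a ^ 2 * w) < 1) (hP : 0 ≤ P)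
    (hf : ∀ n, Measurable fun p : ℝ × (Fin n → ℝ) => f n p.1 p.2)
    (hx : MemLp x₀ 2 μ) (hx2 : ∫ ω, x₀ ω ^ 2 ∂μ = σ₀ ^ 2) (hv : ∀ n < k, AEMeasurable (v n) μ)
    (hpower : discountedPower μ k w f x₀ v ≤ ENNReal.ofReal P) {n : ℕ} (hn : n < k) :
    ∫ ω, state a f (x₀ ω) (fun j => v j ω) n ^ 2 ∂μ ≤ a ^ (2 * n) * powerFactor a w σ₀ P := by
  have hxm := hx.aestronglyMeasurable.aemeasurable
  have hlt : ∀ i ∈ Finset.range n, i < k - 1 := fun i hi => by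
    have := Finset.mem_range.1 hi
    omega
  have hui : ∀ i ∈ Finset.range n,
      Integrable (fun ω => w ^ i * input f (x₀ ω) (fun j => v j ω) i ^ 2) μ := fun i hi =>
    (memLp_input hw0 hw1 hf hxm hv hpower (hlt i hi)).integrable_sq.const_mul _
  have hS := (integrable_finsetSum _ hui).const_mul ((a ^ 2)⁻¹ / (1 - 1 / (a ^ 2 * w)))
  have h2x := hx.integrable_sq.const_mul 2
  have hsum : ∑ i ∈ Finset.range n, w ^ i * ∫ ω, input f (x₀ ω) (fun j => v j ω) i ^ 2 ∂μ ≤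
      P / (1 - w) :=
    (Finset.sum_le_sum_of_subset_of_nonneg
      (Finset.range_subset_range.2 (by omega)) fun i _ _ => by positivity).trans
      (sum_integral_input_sq_le hw0 hw1 hP hf hxm hv hpower)
  refine (integral_mono (memLp_state hw0 hw1 hf hx hv hpower hn).integrable_sq
    ((h2x.add (hS.const_mul 2)).const_mul _)
    fun ω => state_sq_le ha hw0 haw f (x₀ ω) (fun j => v j ω) n).trans ?_
  simp only [Pi.add_apply]
  have h1r : 0 < 1 - 1 / (a ^ 2 * w) := by linarith
  rw [integral_const_mul, integral_add h2x (hS.const_mul 2), integral_const_mul,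
    integral_const_mul, integral_const_mul, integral_finsetSum _ hui, hx2]
  simp_rw [integral_const_mul]
  unfold powerFactor
  have h2n : 0 ≤ a ^ (2 * n) := by
    rw [pow_mul]
    positivity
  gcongr

end Probability

/-! ### The joint law of source and noises -/

namespace SourceAndNoise

variable {Ω : Type*} [MeasurableSpace Ω] {μ : Measure Ω} {k : ℕ} {σ₀ : ℝ} {ν : ℕ → Measure ℝ}
  {x₀ : Ω → ℝ} {v : ℕ → Ω → ℝ}

theorem aemeasurable (hs : SourceAndNoise μ k σ₀ ν x₀ v) (i : Option (Fin k)) :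
    AEMeasurable (i.elim x₀ fun n : Fin k => v n) μ := by
  cases i with
  | none => exact hs.source_law.aemeasurable
  | some n => exact (hs.noise_law n n.2).aemeasurable

/-- Each of the variables `x₀, v 0, …, v (k - 1)` is independent of the tuple of the others. -/
theorem indepFun_compl (hs : SourceAndNoise μ k σ₀ ν x₀ v) (i : Option (Fin k)) :
    IndepFun (fun ω (j : {j // j ≠ i}) => (j : Option (Fin k)).elim x₀ (fun n : Fin k => v n) ω)
      (i.elim x₀ fun n : Fin k => v n) μ := by
  classical
  have h := hs.indep.indepFun_finset₀ (Finset.univ.erase i) {i} (by simp) hs.aemeasurable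
  have hφ : Measurable fun (t : Finset.univ.erase i → ℝ) (j : {j // j ≠ i}) =>
      t ⟨j, Finset.mem_erase.2 ⟨j.2, Finset.mem_univ _⟩⟩ :=
    measurable_pi_lambda _ fun j => measurable_pi_apply _
  have hψ : Measurable fun t : ({i} : Finset (Option (Fin k))) → ℝ =>
      t ⟨i, Finset.mem_singleton_self i⟩ := measurable_pi_apply _
  exact h.comp hφ hψ

theorem hasLaw_prod [IsFiniteMeasure μ] (hs : SourceAndNoise μ k σ₀ ν x₀ v) :
    HasLaw (fun ω => (x₀ ω, fun n : Fin k => v n ω))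
      ((gaussianReal 0 (σ₀ ^ 2).toNNReal).prod (Measure.pi fun n : Fin k => ν n)) μ := by
  have hV : HasLaw (fun ω (n : Fin k) => v n ω) (Measure.pi fun n : Fin k => ν n) μ :=
    (hs.indep.precomp (Option.some_injective (Fin k))).hasLaw_pi fun n => hs.noise_law n n.2
  refine IndepFun.hasLaw_prod hs.source_law hV ?_
  exact ((hs.indepFun_compl none).comp
    (φ := fun t (n : Fin k) => t ⟨some n, Option.some_ne_none n⟩)
    (measurable_pi_lambda _ fun n => measurable_pi_apply _) measurable_id).symm

theorem indepFun_state (hs : SourceAndNoise μ k σ₀ ν x₀ v) {a : ℝ}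
    {f : (n : ℕ) → ℝ → (Fin n → ℝ) → ℝ}
    (hf : ∀ n, Measurable fun p : ℝ × (Fin n → ℝ) => f n p.1 p.2) (n : Fin k) :
    IndepFun (fun ω => state a f (x₀ ω) (fun j => v j ω) n) (v n) μ := by
  -- the tuple without its `n`-th noise, extended by zero, determines the state at time `n`
  let e : ({j : Option (Fin k) // j ≠ some n} → ℝ) → ℝ × (ℕ → ℝ) := fun t =>
    (t ⟨none, (Option.some_ne_none n).symm⟩, fun j =>
      if h : j < n then t ⟨some ⟨j, h.trans n.2⟩, by simpa [Fin.ext_iff] using h.ne⟩ else 0)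
  have he : Measurable e := by
    refine (measurable_pi_apply _).prodMk (measurable_pi_lambda _ fun j => ?_)
    split_ifs with h
    · exact measurable_pi_apply _
    · exact measurable_const
  have h := (hs.indepFun_compl (some n)).comp ((measurable_state (a := a) hf n).comp he)
    measurable_id
  have hcomp : (fun ω => state a f (x₀ ω) (fun j => v j ω) n) =
      ((fun p => state a f p.1 p.2 n) ∘ e) ∘ fun ω (j : {j // j ≠ some n}) =>
        (j : Option (Fin k)).elim x₀ (fun n : Fin k => v n) ω :=
    funext fun ω => state_congr fun j hj => by simp [e, hj]
  rw [hcomp]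
  exact h

end SourceAndNoise

/-! ### The converse bound for the channel -/

section Converse

variable {Ω : Type*} [MeasurableSpace Ω] {μ : Measure Ω} [IsProbabilityMeasure μ]
  {k : ℕ} {a w σ₀ P : ℝ} {ν : ℕ → Measure ℝ} {x₀ : Ω → ℝ} {v : ℕ → Ω → ℝ}
  {f : (n : ℕ) → ℝ → (Fin n → ℝ) → ℝ} {g : (Fin k → ℝ) → ℝ}

/-- The converse bound of `log_div_le_sum` for the feedback channel, with the power of the state
estimated by `a²ⁿ` times `powerFactor`. The reference variances `τ` remain to be chosen. -/
theorem log_div_le_of_meanSquareError_le (ha : a ≠ 0) (hw0 : 0 < w) (hw1 : w < 1)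
    (haw : 1 / (a ^ 2 * w) < 1) (hσ₀ : 0 < σ₀) (hP : 0 ≤ P)
    (hf : ∀ n, Measurable fun p : ℝ × (Fin n → ℝ) => f n p.1 p.2) (hg : Measurable g)
    (hpower : discountedPower μ k w f x₀ v ≤ ENNReal.ofReal P)
    (hs : SourceAndNoise μ k σ₀ ν x₀ v) {τ h m : Fin k → ℝ} (hτ : ∀ i, 0 < τ i)
    (hν : ∀ i : Fin k, IsCentredNoise (ν i) (h i) (m i)) {D : ℝ} (hD : 0 < D)
    (hle : meanSquareError μ k a f g x₀ v ≤ ENNReal.ofReal D) :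
    Real.log (σ₀ ^ 2) - Real.log D ≤ ∑ i : Fin k, (Real.log (2 * Real.pi * τ i) +
      (a ^ (2 * (i : ℕ)) * powerFactor a w σ₀ P + m i) / τ i - 2 * h i) := by
  have hprob : ∀ i : Fin k, IsProbabilityMeasure (ν i) := fun i => (hν i).prob
  have hlaw := hs.hasLaw_prod
  let y : ℝ × (Fin k → ℝ) → Fin k → ℝ := fun z i => observation a f z.1 (extendZero z.2) i
  have hstate : ∀ i : ℕ, Measurable fun z : ℝ × (Fin k → ℝ) =>
      state a f z.1 (extendZero z.2) i := fun i =>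
    (measurable_state hf i).comp (measurable_fst.prodMk (measurable_extendZero.comp measurable_snd))
  have hy : Measurable y := by
    refine measurable_pi_lambda _ fun i => (hstate i).add ?_
    simp only [extendZero_val]
    exact (measurable_pi_apply i).comp measurable_snd
  have hmp : ∀ x, MeasurePreserving fun u => y (x, u) := by
    intro x
    have h := measurePreserving_causalShift (s := fun n v => state a f x v n)
      (fun n => (measurable_state hf n).comp measurable_prodMk_left)
      (fun n v v' hv => state_congr hv) k
    convert h using 3
    simp [y, observation_eq]
  -- the observations do not see the noises after time `k - 1`
  have hyω : ∀ ω, y (x₀ ω, fun n : Fin k => v n ω) =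
      fun i : Fin k => observation a f (x₀ ω) (fun j => v j ω) i := by
    intro ω
    ext i
    simp only [y, observation_eq, extendZero_val]
    exact congrArg (· + _) (state_congr fun j hj => extendZero_of_lt _ (hj.trans i.2))
  have hvm : ∀ n < k, AEMeasurable (v n) μ := fun n hn => (hs.noise_law n hn).aemeasurable
  have hx0 : MemLp x₀ 2 μ := by
    have h2 : MemLp id 2 (μ.map x₀) := by
      rw [hs.source_law.map_eq]
      exact memLp_id_gaussianReal' 2 (by simp)
    exact h2.comp_of_map hs.source_law.aemeasurable
  have hx2 : ∫ ω, x₀ ω ^ 2 ∂μ = σ₀ ^ 2 := by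
    rw [← integral_sq_gaussianReal (sq_nonneg σ₀)]
    exact hs.source_law.integral_comp (f := fun z => z ^ 2) (by fun_prop)
  have hvL : ∀ i : Fin k, MemLp (v i) 2 μ := fun i => by
    have h2 : MemLp id 2 (μ.map (v i)) := by
      rw [(hs.noise_law i i.2).map_eq]
      exact (hν i).memLp
    exact h2.comp_of_map (hvm i i.2)
  have hsL : ∀ i : Fin k, MemLp (fun ω => state a f (x₀ ω) (fun j => v j ω) i) 2 μ := fun i =>
    memLp_state hw0 hw1 hf hx0 hvm hpower i.2
  have hyL : ∀ i : Fin k, MemLp (fun ω => observation a f (x₀ ω) (fun j => v j ω) i) 2 μ :=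
    fun i => (hsL i).add (hvL i)
  have hcross : ∀ i : Fin k,
      ∫ ω, state a f (x₀ ω) (fun j => v j ω) i * v i ω ∂μ = 0 := fun i => by
    have hv0 : ∫ ω, v i ω ∂μ = 0 := (hs.noise_law i i.2).integral_eq.trans (hν i).mean
    rw [(hs.indepFun_state hf i).integral_fun_mul_eq_mul_integral (hsL i).aestronglyMeasurable
      (hvL i).aestronglyMeasurable, hv0, mul_zero]
  have hYμ : ∀ i : Fin k, ∫ ω, observation a f (x₀ ω) (fun j => v j ω) i ^ 2 ∂μ ≤
      a ^ (2 * (i : ℕ)) * powerFactor a w σ₀ P + m i := fun i => by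
    have hexp : ∀ ω, observation a f (x₀ ω) (fun j => v j ω) i ^ 2 =
        state a f (x₀ ω) (fun j => v j ω) i ^ 2 +
          2 * (state a f (x₀ ω) (fun j => v j ω) i * v i ω) + v i ω ^ 2 := fun ω => by
      rw [observation_eq]
      ring
    have hm2 : ∫ ω, v i ω ^ 2 ∂μ = m i := by
      rw [← (hν i).second_moment]
      exact (hs.noise_law i i.2).integral_comp (f := fun z => z ^ 2) (by fun_prop)
    have hc : Integrable (fun ω => 2 * (state a f (x₀ ω) (fun j => v j ω) i * v i ω)) μ :=
      ((hsL i).integrable_mul (hvL i)).const_mul 2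
    have hsc : Integrable (fun ω => state a f (x₀ ω) (fun j => v j ω) i ^ 2 +
        2 * (state a f (x₀ ω) (fun j => v j ω) i * v i ω)) μ := (hsL i).integrable_sq.add hc
    simp_rw [hexp]
    rw [integral_add hsc (hvL i).integrable_sq, integral_add (hsL i).integrable_sq hc,
      integral_const_mul, hcross, hm2]
    linarith [integral_state_sq_le ha hw0 hw1 haw hP hf hx0 hx2 hvm hpower i.2]
  have herrm : AEMeasurable (fun ω => x₀ ω -
      g (fun n : Fin k => observation a f (x₀ ω) (fun j => v j ω) n)) μ :=
    hs.source_law.aemeasurable.sub (hg.comp_aemeasurable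
      (aemeasurable_pi_lambda _ fun i => (hyL i).aestronglyMeasurable.aemeasurable))
  have herrL := memLp_two_of_secondMoment_ne_top herrm (hle.trans_lt ENNReal.ofReal_lt_top).ne
  have herr2 : ∫ ω, (x₀ ω - g (fun n : Fin k => observation a f (x₀ ω) (fun j => v j ω) n)) ^ 2
      ∂μ ≤ D := by
    rw [← ENNReal.ofReal_le_ofReal_iff hD.le, ← secondMoment_eq_ofReal herrL]
    exact hle
  have hym : ∀ i, Measurable fun z => y z i ^ 2 := fun i =>
    ((measurable_pi_apply i).comp hy).pow_const 2
  have hem : Measurable fun z : ℝ × (Fin k → ℝ) => (z.1 - g (y z)) ^ 2 :=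
    (measurable_fst.sub (hg.comp hy)).pow_const 2
  refine log_div_le_sum hσ₀ hD hτ hν hy hmp hg (fun i => ?_) (fun i => ?_) ?_ ?_
  · rw [← hlaw.map_eq, integrable_map_measure (hym i).aestronglyMeasurable hlaw.aemeasurable]
    simpa only [Function.comp_def, hyω] using (hyL i).integrable_sq
  · rw [← hlaw.integral_comp (hym i).aestronglyMeasurable]
    simpa only [Function.comp_def, hyω] using hYμ i
  · rw [← hlaw.map_eq, integrable_map_measure hem.aestronglyMeasurable hlaw.aemeasurable]
    simpa only [Function.comp_def, hyω] using herrL.integrable_sq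
  · rw [← hlaw.integral_comp hem.aestronglyMeasurable]
    simpa only [Function.comp_def, hyω] using herr2

end Converse

/-- A lower bound on `E` follows from a bound on `log D` for the positive reals `D ≥ E`. -/
theorem ofReal_div_le_of_forall_log_le {s I : ℝ} {E : ENNReal} (hs : 0 ≤ s)
    (h : 0 < s → ∀ D : ℝ, 0 < D → E ≤ ENNReal.ofReal D →
      Real.log (s ^ 2) - Real.log D ≤ 2 * I * Real.log 2) :
    ENNReal.ofReal (s ^ 2 / (2 : ℝ) ^ (2 * I)) ≤ E := by
  rcases hs.eq_or_lt with rfl | hs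
  · simp
  by_contra! hcon
  obtain ⟨D, -, hED, hD⟩ := ENNReal.lt_iff_exists_real_btwn.1 hcon
  have hD0 : 0 < D := ENNReal.ofReal_pos.1 (bot_le.trans_lt hED)
  have h2 : (0 : ℝ) < 2 ^ (2 * I) := Real.rpow_pos_of_pos two_pos _
  have hlt := (ENNReal.ofReal_lt_ofReal_iff (by positivity)).1 hD
  have hlog := Real.log_lt_log hD0 hlt
  rw [Real.log_div (by positivity) h2.ne', Real.log_rpow two_pos] at hlog
  linarith [h hs D hD0 hED.le]

/-! ### Evaluation of the information bounds -/

section Bounds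

variable {a w σ₀ σv σv' P : ℝ}

/-- With the common reference variance `τ = σ² (1 + X / (k σ²))`, the sum of `k` Gaussian terms
is at most `k log (1 + X / (k σ²))` as soon as `X` bounds the total power of the states. -/
theorem sum_gaussian_le {k : ℕ} {σ B X : ℝ} (hσ : 0 < σ) (hX0 : 0 ≤ X)
    (hX : ∑ i : Fin k, a ^ (2 * (i : ℕ)) * B ≤ X) :
    ∑ i : Fin k, (Real.log (2 * Real.pi * (σ ^ 2 * (1 + 1 / (k * σ ^ 2) * X))) +
      (a ^ (2 * (i : ℕ)) * B + σ ^ 2) / (σ ^ 2 * (1 + 1 / (k * σ ^ 2) * X)) -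
        2 * ((Real.log (2 * Real.pi * σ ^ 2) + 1) / 2)) ≤
      k * Real.log (1 + 1 / (k * σ ^ 2) * X) := by
  rcases Nat.eq_zero_or_pos k with rfl | hk
  · simp
  have hk' : (0 : ℝ) < k := Nat.cast_pos.2 hk
  set t := 1 + 1 / (k * σ ^ 2) * X with ht
  have ht0 : 0 < t := by positivity
  have hkt : k * (σ ^ 2 * t) = X + k * σ ^ 2 := by
    rw [ht]
    field_simp
    ring
  have hlog : Real.log (2 * Real.pi * (σ ^ 2 * t)) =
      Real.log (2 * Real.pi * σ ^ 2) + Real.log t := by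
    rw [← mul_assoc, Real.log_mul (by positivity) ht0.ne']
  have hfrac : ∑ i : Fin k, (a ^ (2 * (i : ℕ)) * B + σ ^ 2) / (σ ^ 2 * t) ≤ k := by
    rw [← Finset.sum_div, div_le_iff₀ (by positivity), hkt, Finset.sum_add_distrib]
    simpa using hX
  simp_rw [hlog]
  rw [Finset.sum_sub_distrib, Finset.sum_add_distrib]
  simp only [Finset.sum_const, Finset.card_univ, Fintype.card_fin, nsmul_eq_mul]
  linarith

theorem one_lt_sq (ha : a ≠ 0) (hw0 : 0 < w) (hw1 : w < 1) (haw : 1 / (a ^ 2 * w) < 1) :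
    1 < a ^ 2 := by
  have ha2 : 0 < a ^ 2 := by positivity
  rw [div_lt_one (by positivity)] at haw
  nlinarith

/-- The total power of the states, bounded by the partial geometric sum
`(a²ᵏ - 1) / (a² - 1) ≤ a²ᵏ / (a² - 1)`. -/
theorem sum_pow_mul_le {k : ℕ} {B : ℝ} (ha : 1 < a ^ 2) (hB : 0 ≤ B) :
    ∑ i : Fin k, a ^ (2 * (i : ℕ)) * B ≤ a ^ (2 * k) / (a ^ 2 - 1) * B := by
  rw [← Finset.sum_mul, Fin.sum_univ_eq_sum_range (fun i => a ^ (2 * i)) k]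
  simp_rw [pow_mul]
  rw [geom_sum_eq ha.ne']
  have h : 0 < a ^ 2 - 1 := by linarith
  gcongr
  linarith

theorem zpow_two_mul_sub (ha : a ≠ 0) (k j : ℕ) :
    a ^ (2 * ((k : ℤ) - j)) = a ^ (2 * k) * ((a ^ 2)⁻¹) ^ j := by
  rw [mul_sub, zpow_sub₀ ha, inv_pow, ← pow_mul]
  rfl

/-- `2 I_k` in nats; `a²⁽ᵏ⁻¹⁾ / (1 - a⁻²)` is `a²ᵏ / (a² - 1)`. -/
theorem two_mul_infoBound (ha : a ≠ 0) (ha1 : 1 < a ^ 2) (k : ℕ) :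
    2 * infoBound a w σ₀ σv P k * Real.log 2 = k * Real.log (1 + 1 / (k * σv ^ 2) *
      (a ^ (2 * k) / (a ^ 2 - 1) * powerFactor a w σ₀ P)) := by
  have h1 := zpow_two_mul_sub ha k 1
  have h2 := zpow_two_mul_sub ha k 2
  have h3 : a ^ (-2 : ℤ) = (a ^ 2)⁻¹ := by
    rw [zpow_neg]
    rfl
  push_cast at h1 h2
  have hlog2 : Real.log 2 ≠ 0 := (Real.log_pos one_lt_two).ne'
  have h4 : a ^ 2 - 1 ≠ 0 := by linarith
  have h5 : 2 * a ^ (2 * ((k : ℤ) - 1)) * σ₀ ^ 2 / (1 - a ^ (-2 : ℤ)) +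
      2 * a ^ (2 * ((k : ℤ) - 2)) / (1 - a ^ (-2 : ℤ)) *
        (P / ((1 - 1 / (a ^ 2 * w)) * (1 - w))) =
      a ^ (2 * k) / (a ^ 2 - 1) * powerFactor a w σ₀ P := by
    have h6 : 1 - (a ^ 2)⁻¹ = (a ^ 2 - 1) * (a ^ 2)⁻¹ := by field_simp
    rw [h1, h2, h3, h6, powerFactor, ← div_div P]
    generalize 1 - 1 / (a ^ 2 * w) = r
    field_simp
  rw [infoBound, h5, Real.logb]
  field_simp

theorem two_mul_infoBound' (ha : a ≠ 0) (ha1 : 1 < a ^ 2) (n : ℕ) :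
    2 * infoBound' a w σ₀ σv σv' P (n + 1) * Real.log 2 =
      n * Real.log (1 + 1 / (n * σv ^ 2) *
        (a ^ (2 * n) / (a ^ 2 - 1) * powerFactor a w σ₀ P)) +
      Real.log (1 + 1 / σv' ^ 2 * (a ^ (2 * n) * powerFactor a w σ₀ P)) := by
  have h1 := zpow_two_mul_sub ha (n + 1) 1
  have h2 := zpow_two_mul_sub ha (n + 1) 2
  push_cast at h1 h2
  have hlog2 : Real.log 2 ≠ 0 := (Real.log_pos one_lt_two).ne'
  have h5 : 2 * a ^ (2 * (((n + 1 : ℕ) : ℤ) - 1)) * σ₀ ^ 2 +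
      2 * (a ^ (2 * (((n + 1 : ℕ) : ℤ) - 2)) / (1 - 1 / (a ^ 2 * w))) * (P / (1 - w)) =
      a ^ (2 * n) * powerFactor a w σ₀ P := by
    push_cast
    rw [h1, h2, powerFactor]
    generalize 1 - 1 / (a ^ 2 * w) = r
    rw [mul_add 2 n 1, pow_add]
    field_simp
  rw [infoBound', h5, Nat.add_sub_cancel, ← two_mul_infoBound (σv := σv) ha ha1, Real.logb]
  field_simp

theorem two_mul_infoBound'' (n : ℕ) :
    2 * infoBound'' a w σ₀ σv σv' P n * Real.log 2 =
      2 * infoBound' a w σ₀ σv σv' P n * Real.log 2 + Real.log (Real.pi * Real.exp 1 / 2) := by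
  have hlog2 : Real.log 2 ≠ 0 := (Real.log_pos one_lt_two).ne'
  rw [infoBound'', Real.logb]
  field_simp

end Bounds

/-- The converse bound when only the law `ν'` of the last noise is not Gaussian with variance
`σv²`. The last output is compared with a Gaussian law of variance `σv'²` plus the power of the last
state, and `J` bounds the loss `log (2πe σv'²) - 2 h'` in entropy against Gaussian noise of variance
`σv'²`. -/
theorem log_div_le_two_mul_infoBound'_add {Ω : Type*} [MeasurableSpace Ω] {μ : Measure Ω}
    [IsProbabilityMeasure μ] {n : ℕ} {a w σ₀ σv σv' P : ℝ} (ha : a ≠ 0) (hw0 : 0 < w)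
    (hw1 : w < 1) (haw : 1 / (a ^ 2 * w) < 1) (hσ₀ : 0 < σ₀) (hσv : 0 < σv) (hσv' : 0 < σv')
    (hP : 0 ≤ P) {x₀ : Ω → ℝ} {v : ℕ → Ω → ℝ} {f : (n : ℕ) → ℝ → (Fin n → ℝ) → ℝ}
    (hf : ∀ n, Measurable fun p : ℝ × (Fin n → ℝ) => f n p.1 p.2)
    {g : (Fin (n + 1) → ℝ) → ℝ} (hg : Measurable g)
    (hpower : discountedPower μ (n + 1) w f x₀ v ≤ ENNReal.ofReal P)
    {ν' : Measure ℝ} {h' m' J : ℝ} (hν' : IsCentredNoise ν' h' m') (hm' : m' ≤ σv' ^ 2)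
    (hs : SourceAndNoise μ (n + 1) σ₀
        (Function.update (fun _ => gaussianReal 0 (σv ^ 2).toNNReal) n ν') x₀ v)
    (hJ : Real.log (2 * Real.pi * σv' ^ 2) + 1 - 2 * h' ≤ J)
    {D : ℝ} (hD : 0 < D)
    (hle : meanSquareError μ (n + 1) a f g x₀ v ≤ ENNReal.ofReal D) :
    Real.log (σ₀ ^ 2) - Real.log D ≤
      2 * infoBound' a w σ₀ σv σv' P (n + 1) * Real.log 2 + J := by
  have ha1 := one_lt_sq ha hw0 hw1 haw
  have hB := powerFactor_nonneg (σ₀ := σ₀) hw1 haw hP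
  set B := powerFactor a w σ₀ P
  set X := a ^ (2 * n) / (a ^ 2 - 1) * B
  have ha2n : 0 ≤ a ^ (2 * n) := by
    rw [pow_mul]
    positivity
  have hX0 : 0 ≤ X := mul_nonneg (div_nonneg ha2n (by linarith)) hB
  set t' := 1 + 1 / σv' ^ 2 * (a ^ (2 * n) * B) with ht'
  have ht0 : 0 < t' := by positivity
  have key := log_div_le_of_meanSquareError_le ha hw0 hw1 haw hσ₀ hP hf hg hpower hs
    (τ := Fin.snoc (α := fun _ => ℝ) (fun _ : Fin n => σv ^ 2 * (1 + 1 / (n * σv ^ 2) * X))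
      (σv' ^ 2 * t'))
    (h := Fin.snoc (α := fun _ => ℝ) (fun _ : Fin n => (Real.log (2 * Real.pi * σv ^ 2) + 1) / 2)
      h')
    (m := Fin.snoc (α := fun _ => ℝ) (fun _ : Fin n => σv ^ 2) m') ?_ ?_ hD hle
  · rw [Fin.sum_univ_castSucc] at key
    simp only [Fin.snoc_castSucc, Fin.snoc_last, Fin.val_castSucc, Fin.val_last] at key
    have hsum := sum_gaussian_le (k := n) (a := a) hσv hX0 (sum_pow_mul_le ha1 hB)
    have hlast : (a ^ (2 * n) * B + m') / (σv' ^ 2 * t') ≤ 1 := by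
      rw [div_le_one (by positivity)]
      have : σv' ^ 2 * t' = σv' ^ 2 + a ^ (2 * n) * B := by
        rw [ht']
        field_simp
      linarith
    have hlog : Real.log (2 * Real.pi * (σv' ^ 2 * t')) =
        Real.log (2 * Real.pi * σv' ^ 2) + Real.log t' := by
      rw [← mul_assoc, Real.log_mul (by positivity) ht0.ne']
    rw [two_mul_infoBound' ha ha1]
    linarith
  · intro i
    refine Fin.lastCases ?_ (fun j => ?_) i
    · rw [Fin.snoc_last]
      positivity
    · rw [Fin.snoc_castSucc]
      positivity
  · intro i
    refine Fin.lastCases ?_ (fun j => ?_) i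
    · simpa using hν'
    · simpa [j.2.ne] using isCentredNoise_gaussianReal (pow_pos hσv 2)

end StateAmplification

theorem lemma14 {Ω : Type*} [MeasurableSpace Ω] (μ : Measure Ω) [IsProbabilityMeasure μ]
    (k : ℕ) (hk : 1 ≤ k)
    (a w σ₀ σv σv' P : ℝ) (ha : a ≠ 0) (hw0 : 0 < w) (hw1 : w < 1)
    (haw : |1 / (a ^ 2 * w)| < 1)
    (hσ₀ : 0 ≤ σ₀) (hσv : 0 < σv) (hσv' : 0 < σv') (hP : 0 ≤ P)
    (x₀ : Ω → ℝ) (v : ℕ → Ω → ℝ)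
    (f : (n : ℕ) → ℝ → (Fin n → ℝ) → ℝ)
    (hf : ∀ n, Measurable fun p : ℝ × (Fin n → ℝ) => f n p.1 p.2)
    (g : (Fin k → ℝ) → ℝ) (hg : Measurable g)
    (hpower : StateAmplification.discountedPower μ k w f x₀ v ≤ ENNReal.ofReal P) :
    (StateAmplification.SourceAndNoise μ k σ₀
        (fun _ => gaussianReal 0 (σv ^ 2).toNNReal) x₀ v →
      ENNReal.ofReal
          (σ₀ ^ 2 / (2 : ℝ) ^ (2 * StateAmplification.infoBound a w σ₀ σv P k)) ≤
        StateAmplification.meanSquareError μ k a f g x₀ v) ∧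
    (StateAmplification.SourceAndNoise μ k σ₀
        (Function.update (fun _ => gaussianReal 0 (σv ^ 2).toNNReal) (k - 1)
          (gaussianReal 0 (σv' ^ 2).toNNReal)) x₀ v →
      ENNReal.ofReal
          (σ₀ ^ 2 / (2 : ℝ) ^ (2 * StateAmplification.infoBound' a w σ₀ σv σv' P k)) ≤
        StateAmplification.meanSquareError μ k a f g x₀ v) ∧
    (StateAmplification.SourceAndNoise μ k σ₀
        (Function.update (fun _ => gaussianReal 0 (σv ^ 2).toNNReal) (k - 1)
          (StateAmplification.uniformNoise σv')) x₀ v →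
      ENNReal.ofReal
          (σ₀ ^ 2 / (2 : ℝ) ^ (2 * StateAmplification.infoBound'' a w σ₀ σv σv' P k)) ≤
        StateAmplification.meanSquareError μ k a f g x₀ v) := by
  have haw' : 1 / (a ^ 2 * w) < 1 := (abs_lt.1 haw).2
  refine ⟨fun hs => ?_, fun hs => ?_, fun hs => ?_⟩ <;>
    refine StateAmplification.ofReal_div_le_of_forall_log_le hσ₀ fun hσ D hD hle => ?_
  · have ha1 := StateAmplification.one_lt_sq ha hw0 hw1 haw'
    have hB := StateAmplification.powerFactor_nonneg (σ₀ := σ₀) hw1 haw' hP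
    have hX : 0 ≤ a ^ (2 * k) / (a ^ 2 - 1) *
        StateAmplification.powerFactor a w σ₀ P := by
      rw [pow_mul]
      exact mul_nonneg (div_nonneg (by positivity) (by linarith)) hB
    rw [StateAmplification.two_mul_infoBound ha ha1]
    exact (StateAmplification.log_div_le_of_meanSquareError_le ha hw0 hw1 haw' hσ hP hf hg hpower hs
      (fun _ => by positivity)
      (fun _ => StateAmplification.isCentredNoise_gaussianReal (pow_pos hσv 2)) hD hle).trans
      (StateAmplification.sum_gaussian_le hσv hX (StateAmplification.sum_pow_mul_le ha1 hB))
  · obtain ⟨n, rfl⟩ : ∃ n, k = n + 1 := ⟨k - 1, by omega⟩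
    rw [← add_zero (2 * _ * Real.log 2)]
    exact StateAmplification.log_div_le_two_mul_infoBound'_add ha hw0 hw1 haw' hσ hσv hσv' hP hf hg
      hpower (StateAmplification.isCentredNoise_gaussianReal (pow_pos hσv' 2)) le_rfl hs
      (by linarith) hD hle
  · obtain ⟨n, rfl⟩ : ∃ n, k = n + 1 := ⟨k - 1, by omega⟩
    rw [StateAmplification.two_mul_infoBound'']
    refine StateAmplification.log_div_le_two_mul_infoBound'_add ha hw0 hw1 haw' hσ hσv hσv' hP hf hg
      hpower (StateAmplification.isCentredNoise_uniformNoise hσv') (by nlinarith) hs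
      (le_of_eq ?_) hD hle
    -- the entropy of uniform noise falls short of the Gaussian one by `log (πe/2) / 2`
    have hentropy : 2 * Real.log (2 * σv') = Real.log ((2 * σv') ^ 2) := by
      rw [Real.log_pow]
      norm_num
    rw [hentropy, ← Real.log_exp 1, ← Real.log_mul (by positivity) (by positivity),
      ← Real.log_div (by positivity) (by positivity)]
    congr 1
    rw [Real.log_exp]
    field_simp
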